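/- For a $2\times 2$ unitary matrix $U$ with columns $|u_0\rangle,|u_1\rangle$ let $\mathcal P_U$ be the associated von Neumann measurement, viewed as the linear map $\mathcal P_U(\rho)=\sum_{i=0}^{1}\langle u_i|\rho|u_i\rangle\,|i\rangle\langle i|$ on $2\times2$ complex matrices. Let $\|\cdot\|_1$ be the trace norm, and put $$\|\mathcal P_U-\mathcal P_V\|_\diamond=\max_{|\psi\rangle\in\mathbb C^2\otimes\mathbb C^2,\ \|\psi\|=1}\big\|\big((\mathcal P_U-\mathcal P_V)\otimes\mathbb 1\big)(|\psi\rangle\langle\psi|)\big\|_1 .$$ A unit vector $|\psi\rangle$ at which this maximum is attained is called a discriminator for $\mathcal P_U$ and $\mathcal P_V$ (an optimal input state for discriminating between them). Let $H=\frac1{\sqrt2}\begin{pmatrix}1&1\\1&-1\end{pmatrix}$ and, for $\phi\in\mathbb R$, let $U_\phi=H\,\mathrm{diag}(1,e^{i\phi})\,H^\dagger$. For a matrix $A$ write $|A\rangle\rangle=\sum_{i,j}A_{ij}\,|i\rangle|j\rangle$. **Proposition.** Let $|\psi_0\rangle=\frac1{\sqrt2}|\mathbb 1_2\rangle\rangle$.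 Then $|\psi_0\rangle=\frac1{\sqrt2}(|00\rangle+|11\rangle)$ is the Bell state, which does not depend on $\phi$, and for every $\phi\in\mathbb R$ it is a discriminator for $\mathcal P_{U_\phi}$ and $\mathcal P_{\mathbb 1}$. Moreover $$\big\|\big((\mathcal P_{U_\phi}-\mathcal P_{\mathbb 1})\otimes\mathbb 1\big)(|\psi_0\rangle\langle\psi_0|)\big\|_1=\|\mathcal P_{U_\phi}-\mathcal P_{\mathbb 1}\|_\diamond=|1-e^{i\phi}| .$$ -/

import Mathlib

open scoped Kronecker

noncomputable section

namespace Discrimination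

/-- The map `Φ ⊗ 𝟙` on matrices over the joint system, acting as `Φ` on the first subsystem and
trivially on the second one (see `tensorId_kronecker`). -/
def tensorId {ι κ α : Type*} (Φ : Matrix ι ι ℂ →ₗ[ℂ] Matrix κ κ ℂ) :
    Matrix (ι × α) (ι × α) ℂ →ₗ[ℂ] Matrix (κ × α) (κ × α) ℂ where
  toFun X := Matrix.of fun p q => Φ (Matrix.of fun i j => X (i, p.2) (j, q.2)) p.1 q.1
  map_add' X Y := by
    ext p q
    exact congrFun (congrFun (map_add Φ (Matrix.of fun i j => X (i, p.2) (j, q.2))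
      (Matrix.of fun i j => Y (i, p.2) (j, q.2))) p.1) q.1
  map_smul' c X := by
    ext p q
    exact congrFun (congrFun (map_smul Φ c (Matrix.of fun i j => X (i, p.2) (j, q.2))) p.1) q.1

/-- `Φ ⊗ 𝟙` sends `A ⊗ B` to `Φ(A) ⊗ B`. -/
theorem tensorId_kronecker {ι κ α : Type*} (Φ : Matrix ι ι ℂ →ₗ[ℂ] Matrix κ κ ℂ)
    (A : Matrix ι ι ℂ) (B : Matrix α α ℂ) : tensorId Φ (A ⊗ₖ B) = Φ A ⊗ₖ B := by
  ext p q
  have h : (Matrix.of fun i j => (A ⊗ₖ B) (i, p.2) (j, q.2)) = B p.2 q.2 • A := by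
    ext i j
    simp [mul_comm]
  change Φ (Matrix.of fun i j => (A ⊗ₖ B) (i, p.2) (j, q.2)) p.1 q.1 = _
  rw [h, map_smul]
  simp [mul_comm]

variable {ι κ : Type*} [Fintype ι] [DecidableEq ι] [Fintype κ] [DecidableEq κ]

/-- The trace norm `‖A‖₁ = tr √(A†A)`: the sum of the singular values of `A`, that is, of the
square roots of the eigenvalues of `A†A` counted with multiplicity. -/
def traceNorm (A : Matrix κ ι ℂ) : ℝ :=
  ∑ i, Real.sqrt ((Matrix.isHermitian_conjTranspose_mul_self A).eigenvalues i)

/-- The measure-and-prepare channel `P_U : ρ ↦ ∑ i, ⟨u_i|ρ|u_i⟩ |i⟩⟨i|` of the von Neumann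
measurement described by the unitary matrix `U`, where `u_i` is the `i`-th column of `U`. -/
def vonNeumann (U : Matrix.unitaryGroup ι ℂ) : Matrix ι ι ℂ →ₗ[ℂ] Matrix ι ι ℂ where
  toFun ρ := ∑ i, (star ((U : Matrix ι ι ℂ).col i) ⬝ᵥ (ρ.mulVec ((U : Matrix ι ι ℂ).col i))) •
    Matrix.single i i (1 : ℂ)
  map_add' ρ σ := by
    simp only [Matrix.add_mulVec, dotProduct_add, add_smul, Finset.sum_add_distrib]
  map_smul' c ρ := by
    simp only [Matrix.smul_mulVec, dotProduct_smul, smul_assoc, Finset.smul_sum, RingHom.id_apply]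

/-- The operator `|ψ⟩⟨ψ|`. -/
def proj (ψ : EuclideanSpace ℂ ι) : Matrix ι ι ℂ := Matrix.vecMulVec ψ (star ⇑ψ)

/-- `‖(Φ ⊗ 𝟙)(|ψ⟩⟨ψ|)‖₁`, for a pure input state `ψ` of the system and an auxiliary system of the
same dimension. -/
def outputTraceNorm (Φ : Matrix ι ι ℂ →ₗ[ℂ] Matrix κ κ ℂ) (ψ : EuclideanSpace ℂ (ι × ι)) : ℝ :=
  traceNorm (tensorId Φ (proj ψ))

/-- The diamond norm `max_{‖ψ‖ = 1} ‖(Φ ⊗ 𝟙)(|ψ⟩⟨ψ|)‖₁` of a Hermiticity-preserving map `Φ`, such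
as a difference of two channels. -/
def diamondNorm (Φ : Matrix ι ι ℂ →ₗ[ℂ] Matrix κ κ ℂ) : ℝ :=
  sSup (outputTraceNorm Φ '' {ψ | ‖ψ‖ = 1})

/-- A discriminator for `P_U` and `P_V`: a unit vector `ψ` at which the maximum in the definition
of the diamond norm of `P_U - P_V` is attained. -/
def IsDiscriminator (U V : Matrix.unitaryGroup ι ℂ) (ψ : EuclideanSpace ℂ (ι × ι)) : Prop :=
  ‖ψ‖ = 1 ∧ ∀ χ : EuclideanSpace ℂ (ι × ι), ‖χ‖ = 1 →
    outputTraceNorm (vonNeumann U - vonNeumann V) χ ≤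
      outputTraceNorm (vonNeumann U - vonNeumann V) ψ

/-- The Hadamard matrix of dimension two. -/
def hadamard : Matrix (Fin 2) (Fin 2) ℂ := ((Real.sqrt 2 : ℂ))⁻¹ • !![1, 1; 1, -1]

theorem hadamard_mem : hadamard ∈ Matrix.unitaryGroup (Fin 2) ℂ := by
  have h : ((Real.sqrt 2 : ℂ))⁻¹ * ((Real.sqrt 2 : ℂ))⁻¹ = 1 / 2 := by
    rw [← mul_inv, ← Complex.ofReal_mul, Real.mul_self_sqrt (by norm_num)]
    norm_num
  rw [Matrix.mem_unitaryGroup_iff]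
  ext i j
  fin_cases i <;> fin_cases j <;>
    simp [hadamard, Matrix.mul_apply, Matrix.star_eq_conjTranspose, h] <;> norm_num

/-- `diag(1, e^{iφ})`. -/
def phaseGate (φ : ℝ) : Matrix (Fin 2) (Fin 2) ℂ :=
  Matrix.diagonal ![1, Complex.exp (Complex.I * φ)]

theorem phaseGate_mem (φ : ℝ) : phaseGate φ ∈ Matrix.unitaryGroup (Fin 2) ℂ := by
  have h : Complex.exp (Complex.I * φ) * (starRingEnd ℂ) (Complex.exp (Complex.I * φ)) = 1 := by
    rw [Complex.mul_conj, Complex.normSq_eq_norm_sq, mul_comm, Complex.norm_exp_ofReal_mul_I]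
    norm_num
  rw [Matrix.mem_unitaryGroup_iff]
  ext i j
  fin_cases i <;> fin_cases j <;>
    simp [phaseGate, Matrix.mul_apply, Matrix.star_eq_conjTranspose, h]

/-- `U_φ = H diag(1, e^{iφ}) H†`. -/
def fourierUnitary (φ : ℝ) : Matrix.unitaryGroup (Fin 2) ℂ :=
  ⟨hadamard * phaseGate φ * hadamard.conjTranspose,
    mul_mem (mul_mem hadamard_mem (phaseGate_mem φ)) (Unitary.star_mem hadamard_mem)⟩

/-- The vectorization `|A⟩⟩ = ∑ i j, A i j |i⟩|j⟩`. -/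
def vectorize (A : Matrix ι ι ℂ) : EuclideanSpace ℂ (ι × ι) :=
  WithLp.toLp 2 fun p => A p.1 p.2

/-- The computational basis vector `|ij⟩` of two qubits. -/
def ket (i j : Fin 2) : EuclideanSpace ℂ (Fin 2 × Fin 2) := EuclideanSpace.single (i, j) 1

/-- The state `(1/√2) |𝟙₂⟩⟩`. -/
def bellState : EuclideanSpace ℂ (Fin 2 × Fin 2) :=
  ((Real.sqrt 2 : ℂ))⁻¹ • vectorize (1 : Matrix (Fin 2) (Fin 2) ℂ)

end Discrimination

end

/-! Write `G` for `effectGap φ`. The two outcome probabilities have the same sum for both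
measurements, so their difference sends `ρ` to `tr(ρ Gᵀ) Z` with `Z = diag(1, -1)`. If the
amplitudes of the input `χ` form the matrix `X`, the output is `Z ⊗ XᵀGX̄`. Since `G†G = (1 - cos
φ)/2 • 1`, factoring it as `(Z ⊗ XᵀG)(1 ⊗ X̄)` gives Frobenius norms `√(1 - cos φ)` and `√2` for
every unit `χ`. By `traceNorm_mul_le` the trace norm is at most `√(2 - 2 cos φ) = |1 - e^{iφ}|`. For
the Bell state the output is `Z ⊗ G/2`, a multiple of a unitary, and the bound is attained. -/

noncomputable section

namespace Discrimination

/-! ### Trace norm: singular vectors and a Hölder-type bound. -/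

section TraceNorm

variable {ι κ μ : Type*} [Fintype ι] [DecidableEq ι] [Fintype κ] [Fintype μ]

/-- The image under `A` of the `i`-th vector of the orthonormal eigenbasis of `A†A`. -/
def eigenImage (A : Matrix κ ι ℂ) (i : ι) : EuclideanSpace ℂ κ :=
  WithLp.toLp 2 (A.mulVec ⇑((Matrix.isHermitian_conjTranspose_mul_self A).eigenvectorBasis i))

theorem inner_eigenImage (A : Matrix κ ι ℂ) (i j : ι) :
    inner ℂ (eigenImage A i) (eigenImage A j) =
      ((Matrix.isHermitian_conjTranspose_mul_self A).eigenvalues j : ℂ) *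
        if i = j then 1 else 0 := by
  have h := (Matrix.isHermitian_conjTranspose_mul_self A).mulVec_eigenvectorBasis j
  have ho := orthonormal_iff_ite.mp
    (Matrix.isHermitian_conjTranspose_mul_self A).eigenvectorBasis.orthonormal i j
  unfold eigenImage
  rw [EuclideanSpace.inner_eq_star_dotProduct] at ho ⊢
  rw [← ho]
  simp only [Matrix.star_mulVec]
  rw [dotProduct_comm, ← Matrix.dotProduct_mulVec, Matrix.mulVec_mulVec, h, dotProduct_comm,
    smul_dotProduct, Complex.real_smul]

theorem norm_eigenImage (A : Matrix κ ι ℂ) (i : ι) :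
    ‖eigenImage A i‖ =
      Real.sqrt ((Matrix.isHermitian_conjTranspose_mul_self A).eigenvalues i) := by
  have h := inner_eigenImage A i i
  rw [if_pos rfl, mul_one, inner_self_eq_norm_sq_to_K] at h
  have h' : ‖eigenImage A i‖ ^ 2 =
      (Matrix.isHermitian_conjTranspose_mul_self A).eigenvalues i := Complex.ofReal_injective (by simpa using h)
  rw [← h', Real.sqrt_sq (norm_nonneg _)]

theorem traceNorm_of_conjTranspose_mul_self_eq_smul_one (A : Matrix κ ι ℂ) (r : ℝ) (hr : 0 ≤ r)
    (h : A.conjTranspose * A = ((r ^ 2 : ℝ) : ℂ) • (1 : Matrix ι ι ℂ)) :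
    traceNorm A = Fintype.card ι * r := by
  have key : ∀ i, (Matrix.isHermitian_conjTranspose_mul_self A).eigenvalues i = r ^ 2 := by
    intro i
    have ho := (Matrix.isHermitian_conjTranspose_mul_self A).eigenvectorBasis.orthonormal.1 i
    have he := (Matrix.isHermitian_conjTranspose_mul_self A).eigenvalues_eq i
    have hi := inner_self_eq_norm_sq_to_K (𝕜 := ℂ)
      ((Matrix.isHermitian_conjTranspose_mul_self A).eigenvectorBasis i)
    rw [ho, EuclideanSpace.inner_eq_star_dotProduct, dotProduct_comm] at hi
    have hm := congrArg (fun M => M.mulVec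
      ⇑((Matrix.isHermitian_conjTranspose_mul_self A).eigenvectorBasis i)) h
    simp only [Matrix.smul_mulVec, Matrix.one_mulVec] at hm
    rw [he, hm, dotProduct_smul, hi]
    simp only [Complex.coe_algebraMap, smul_eq_mul]
    norm_num [-Complex.ofReal_pow]
  simp [traceNorm, key, Real.sqrt_sq hr]

/-- Cauchy–Schwarz over the pairs `(i, m)`, then Bessel's inequality for each `m`. -/
theorem sum_norm_inner_mul_norm_inner_le {S E F : Type*} [Fintype S]
    [NormedAddCommGroup E] [InnerProductSpace ℂ E] [NormedAddCommGroup F] [InnerProductSpace ℂ F]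
    {v : S → F} (hv : Orthonormal ℂ v) {b : S → E} (hb : Orthonormal ℂ b)
    (β : μ → F) (γ : μ → E) :
    ∑ i, ∑ m, ‖inner ℂ (v i) (β m)‖ * ‖inner ℂ (b i) (γ m)‖ ≤
      Real.sqrt (∑ m, ‖β m‖ ^ 2) * Real.sqrt (∑ m, ‖γ m‖ ^ 2) := by
  have hβ : ∑ p : S × μ, ‖inner ℂ (v p.1) (β p.2)‖ ^ 2 ≤ ∑ m, ‖β m‖ ^ 2 := by
    rw [Fintype.sum_prod_type_right]
    exact Finset.sum_le_sum fun m _ => hv.sum_inner_products_le (β m)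
  have hγ : ∑ p : S × μ, ‖inner ℂ (b p.1) (γ p.2)‖ ^ 2 ≤ ∑ m, ‖γ m‖ ^ 2 := by
    rw [Fintype.sum_prod_type_right]
    exact Finset.sum_le_sum fun m _ => hb.sum_inner_products_le (γ m)
  rw [← Fintype.sum_prod_type (fun p : S × μ =>
    ‖inner ℂ (v p.1) (β p.2)‖ * ‖inner ℂ (b p.1) (γ p.2)‖)]
  exact (Real.sum_mul_le_sqrt_mul_sqrt _ _ _).trans (mul_le_mul (Real.sqrt_le_sqrt hβ)
    (Real.sqrt_le_sqrt hγ) (Real.sqrt_nonneg _) (Real.sqrt_nonneg _))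

/-- Column-times-row expansion of `B * C`. The rows of `C` are conjugated because `inner` is
conjugate-linear in its first argument. -/
theorem toLp_mul_mulVec {ι κ μ : Type*} [Fintype ι] [Fintype μ] (B : Matrix κ μ ℂ) (C : Matrix μ ι ℂ) (x : EuclideanSpace ℂ ι) :
    (WithLp.toLp 2 ((B * C).mulVec ⇑x) : EuclideanSpace ℂ κ) =
      ∑ m, inner ℂ (WithLp.toLp 2 fun i => star (C m i) : EuclideanSpace ℂ ι) x •
        (WithLp.toLp 2 fun k => B k m : EuclideanSpace ℂ κ) := by
  ext k
  rw [← Matrix.mulVec_mulVec]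
  simp [Matrix.mulVec, dotProduct, PiLp.inner_apply, mul_comm]

/-- Vanishing images contribute nothing; dropping them lets the others be normalized. -/
theorem traceNorm_eq_sum_norm_eigenImage (A : Matrix κ ι ℂ) :
    traceNorm A = ∑ i : {i : ι // eigenImage A i ≠ 0}, ‖eigenImage A i‖ := by
  rw [← Finset.sum_subtype (Finset.univ.filter fun i => eigenImage A i ≠ 0) (by simp)
    (fun i => ‖eigenImage A i‖), Finset.sum_filter_of_ne]
  · exact Finset.sum_congr rfl fun i _ => (norm_eigenImage A i).symm
  · intro i _ hi h0
    exact hi (by rw [h0, norm_zero])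

theorem orthonormal_normalized_eigenImage (A : Matrix κ ι ℂ) :
    Orthonormal ℂ fun i : {i : ι // eigenImage A i ≠ 0} =>
      ((‖eigenImage A i‖⁻¹ : ℝ) : ℂ) • eigenImage A i := by
  refine ⟨fun i => ?_, fun i j hij => ?_⟩
  · simp only [norm_smul, Complex.norm_real, norm_inv, norm_norm]
    exact inv_mul_cancel₀ (norm_ne_zero_iff.mpr i.2)
  · simp only [inner_smul_left, inner_smul_right, inner_eigenImage]
    rw [if_neg (fun h => hij (Subtype.ext h))]
    simp

/-- The trace norm of a product is at most the product of the Frobenius norms of the factors. -/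
theorem traceNorm_mul_le (B : Matrix κ μ ℂ) (C : Matrix μ ι ℂ) :
    traceNorm (B * C) ≤
      Real.sqrt (∑ m, ∑ k, ‖B k m‖ ^ 2) * Real.sqrt (∑ m, ∑ i, ‖C m i‖ ^ 2) := by
  let β : μ → EuclideanSpace ℂ κ := fun m => WithLp.toLp 2 fun k => B k m
  let γ : μ → EuclideanSpace ℂ ι := fun m => WithLp.toLp 2 fun i => star (C m i)
  have hβ : ∑ m, ∑ k, ‖B k m‖ ^ 2 = ∑ m, ‖β m‖ ^ 2 := by
    simp [β, EuclideanSpace.norm_sq_eq]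
  have hγ : ∑ m, ∑ i, ‖C m i‖ ^ 2 = ∑ m, ‖γ m‖ ^ 2 := by
    simp [γ, EuclideanSpace.norm_sq_eq]
  have hb := (Matrix.isHermitian_conjTranspose_mul_self
    (B * C)).eigenvectorBasis.orthonormal.comp
      (Subtype.val : {i : ι // eigenImage (B * C) i ≠ 0} → ι) Subtype.val_injective
  rw [traceNorm_eq_sum_norm_eigenImage, hβ, hγ]
  refine le_trans (Finset.sum_le_sum fun i _ => ?_)
    (sum_norm_inner_mul_norm_inner_le (orthonormal_normalized_eigenImage (B * C)) hb β γ)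
  -- Each singular value is the matrix element `⟨v_i, BC b_i⟩` between the normalized image `v_i`
  -- and the eigenvector `b_i`; expanding `BC` turns it into a sum over `m`.
  have h1 : inner ℂ (((‖eigenImage (B * C) i‖⁻¹ : ℝ) : ℂ) • eigenImage (B * C) i)
      (eigenImage (B * C) i) = ((‖eigenImage (B * C) i‖ : ℝ) : ℂ) := by
    have hne : ‖eigenImage (B * C) i‖ ≠ 0 := norm_ne_zero_iff.mpr i.2
    rw [inner_smul_left, inner_self_eq_norm_sq_to_K, Complex.conj_ofReal]
    change ((‖eigenImage (B * C) i‖⁻¹ : ℝ) : ℂ) * (‖eigenImage (B * C) i‖ : ℂ) ^ 2 = _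
    rw [← Complex.ofReal_pow, ← Complex.ofReal_mul]
    congr 1
    field_simp
  have h2 : eigenImage (B * C) i = _ := toLp_mul_mulVec B C _
  have h3 : ‖eigenImage (B * C) i‖ = _ :=
    (norm_norm _).symm.trans ((Complex.norm_real _).symm.trans (congrArg norm (h1.symm.trans
      (congrArg (inner ℂ _) h2))))
  rw [inner_sum] at h3
  refine h3.trans_le ?_
  refine (norm_sum_le _ _).trans (Finset.sum_le_sum fun m _ => ?_)
  rw [inner_smul_right, norm_mul, mul_comm, norm_inner_symm (𝕜 := ℂ) _
    ((Matrix.isHermitian_conjTranspose_mul_self (B * C)).eigenvectorBasis i)]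
  rfl

end TraceNorm

/-! ### The difference of the two measurements. -/

/-- The operator `|u₀⟩⟨u₀| - |0⟩⟨0|`, transposed, for the first column `u₀` of `U_φ`. -/
def effectGap (φ : ℝ) : Matrix (Fin 2) (Fin 2) ℂ :=
  (2 : ℂ)⁻¹ • !![-(1 - (Real.cos φ : ℂ)), -(Complex.I * Real.sin φ);
    Complex.I * Real.sin φ, 1 - (Real.cos φ : ℂ)]

theorem exp_I_mul_eq (φ : ℝ) :
    Complex.exp (Complex.I * φ) = (Real.cos φ : ℂ) + Complex.I * (Real.sin φ : ℂ) := by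
  rw [mul_comm, Complex.exp_mul_I, Complex.ofReal_cos, Complex.ofReal_sin, mul_comm Complex.I]

theorem norm_one_sub_exp_sq (φ : ℝ) :
    ‖1 - Complex.exp (Complex.I * φ)‖ ^ 2 = 2 - 2 * Real.cos φ := by
  rw [exp_I_mul_eq, ← Complex.normSq_eq_norm_sq, Complex.normSq_apply]
  simp only [Complex.sub_re, Complex.add_re, Complex.mul_re, Complex.sub_im, Complex.add_im,
    Complex.mul_im, Complex.I_re, Complex.I_im, Complex.ofReal_re, Complex.ofReal_im,
    Complex.one_re, Complex.one_im]
  linear_combination Real.sin_sq_add_cos_sq φ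

theorem fourierUnitary_coe (φ : ℝ) :
    (fourierUnitary φ : Matrix (Fin 2) (Fin 2) ℂ) =
      !![(1 + Complex.exp (Complex.I * φ)) / 2, (1 - Complex.exp (Complex.I * φ)) / 2;
        (1 - Complex.exp (Complex.I * φ)) / 2, (1 + Complex.exp (Complex.I * φ)) / 2] := by
  have hs : ((Real.sqrt 2 : ℂ))⁻¹ * ((Real.sqrt 2 : ℂ))⁻¹ = 1 / 2 := by
    rw [← mul_inv, ← Complex.ofReal_mul, Real.mul_self_sqrt (by norm_num)]
    norm_num
  change hadamard * phaseGate φ * hadamard.conjTranspose = _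
  generalize hz : Complex.exp (Complex.I * φ) = z
  ext i j
  rw [Matrix.mul_apply, Fin.sum_univ_two, Matrix.mul_apply, Matrix.mul_apply, Fin.sum_univ_two,
    Fin.sum_univ_two]
  fin_cases i <;> fin_cases j <;> simp [hadamard, phaseGate, hz]
  · linear_combination (1 + z) * hs
  · linear_combination (1 - z) * hs
  · linear_combination (1 - z) * hs
  · linear_combination (1 + z) * hs

theorem vonNeumann_apply {ι : Type*} [Fintype ι] [DecidableEq ι] (U : Matrix.unitaryGroup ι ℂ)
    (ρ : Matrix ι ι ℂ) (i j : ι) :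
    vonNeumann U ρ i j = if i = j then
      ∑ k, ∑ l, star ((U : Matrix ι ι ℂ) k i) * ρ k l * (U : Matrix ι ι ℂ) l i else 0 := by
  change (∑ k, (star ((U : Matrix ι ι ℂ).col k) ⬝ᵥ (ρ.mulVec ((U : Matrix ι ι ℂ).col k))) •
    Matrix.single k k (1 : ℂ)) i j = _
  rw [Matrix.sum_apply]
  split_ifs with h
  · subst h
    rw [Finset.sum_eq_single i]
    · simp [dotProduct, Matrix.mulVec, Finset.mul_sum, mul_assoc]
    · intro k _ hk
      simp [hk]
    · simp
  · refine Finset.sum_eq_zero fun k _ => ?_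
    rw [Matrix.smul_apply, Matrix.single_apply, if_neg (by rintro ⟨rfl, rfl⟩; exact h rfl),
      smul_zero]

theorem vonNeumann_sub_apply (φ : ℝ) (ρ : Matrix (Fin 2) (Fin 2) ℂ) (i j : Fin 2) :
    (vonNeumann (fourierUnitary φ) ρ - vonNeumann 1 ρ) i j =
      if i = j then (if i = 0 then 1 else -1) * ∑ p, ∑ q, ρ q p * effectGap φ q p else 0 := by
  have hcs : (Real.cos φ : ℂ) ^ 2 + (Real.sin φ : ℂ) ^ 2 = 1 := by
    rw [← Complex.ofReal_pow, ← Complex.ofReal_pow, ← Complex.ofReal_add,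
      Real.cos_sq_add_sin_sq, Complex.ofReal_one]
  have hI := Complex.I_sq
  have h2 : (starRingEnd ℂ) 2 = 2 := map_ofNat _ 2
  rw [Matrix.sub_apply, vonNeumann_apply, vonNeumann_apply,
    fourierUnitary_coe, exp_I_mul_eq, effectGap]
  generalize Real.cos φ = x at *
  generalize Real.sin φ = y at *
  fin_cases i <;> fin_cases j <;> simp [Fin.sum_univ_two, h2]
  all_goals
    linear_combination (hcs - (y : ℂ) ^ 2 * hI) / 4 * (ρ 0 0 - ρ 0 1 - ρ 1 0 + ρ 1 1)

theorem tensorId_sub_apply (φ : ℝ) (χ : EuclideanSpace ℂ (Fin 2 × Fin 2)) (i j a b : Fin 2) :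
    tensorId (vonNeumann (fourierUnitary φ) - vonNeumann 1) (proj χ) (i, a) (j, b) =
      if i = j then (if i = 0 then 1 else -1) *
        ∑ p, ∑ q, χ (q, a) * star (χ (p, b)) * effectGap φ q p else 0 := by
  exact vonNeumann_sub_apply φ (Matrix.of fun k l => proj χ (k, a) (l, b)) i j

/-- `effectGap φ` is `√((1 - cos φ)/2)` times a unitary, so it scales the norm of every row vector
alike. -/
theorem norm_vecMul_effectGap_sq (φ : ℝ) (z w : ℂ) :
    ‖z * effectGap φ 0 0 + w * effectGap φ 1 0‖ ^ 2 +
      ‖z * effectGap φ 0 1 + w * effectGap φ 1 1‖ ^ 2 =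
      (1 - Real.cos φ) / 2 * (‖z‖ ^ 2 + ‖w‖ ^ 2) := by
  have hcs := Real.sin_sq_add_cos_sq φ
  have h00 : effectGap φ 0 0 = ((-(1 - Real.cos φ) / 2 : ℝ) : ℂ) := by
    simp [effectGap]; ring
  have h11 : effectGap φ 1 1 = (((1 - Real.cos φ) / 2 : ℝ) : ℂ) := by
    simp [effectGap]; ring
  have h01 : effectGap φ 0 1 = ((-Real.sin φ / 2 : ℝ) : ℂ) * Complex.I := by
    simp [effectGap]; ring
  have h10 : effectGap φ 1 0 = ((Real.sin φ / 2 : ℝ) : ℂ) * Complex.I := by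
    simp [effectGap]; ring
  rw [h00, h11, h01, h10]
  simp only [← Complex.normSq_eq_norm_sq, Complex.normSq_apply, Complex.add_re, Complex.mul_re,
    Complex.add_im, Complex.mul_im, Complex.I_re, Complex.I_im, Complex.ofReal_re,
    Complex.ofReal_im]
  linear_combination (z.re ^ 2 + z.im ^ 2 + w.re ^ 2 + w.im ^ 2) / 4 * hcs

/-! ### Upper bound for an arbitrary input state. -/

theorem outputTraceNorm_le (φ : ℝ) (χ : EuclideanSpace ℂ (Fin 2 × Fin 2)) (hχ : ‖χ‖ = 1) :
    outputTraceNorm (vonNeumann (fourierUnitary φ) - vonNeumann 1) χ ≤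
      ‖1 - Complex.exp (Complex.I * φ)‖ := by
  -- `B = Z ⊗ XᵀG` and `C = 1 ⊗ X̄`, where `X q a = χ (q, a)`.
  let B : Matrix (Fin 2 × Fin 2) (Fin 2 × Fin 2) ℂ := Matrix.of fun r m =>
    if r.1 = m.1 then (if r.1 = 0 then 1 else -1) * ∑ q, χ (q, r.2) * effectGap φ q m.2 else 0
  let C : Matrix (Fin 2 × Fin 2) (Fin 2 × Fin 2) ℂ := Matrix.of fun m s =>
    if m.1 = s.1 then star (χ (m.2, s.2)) else 0
  have hBC : tensorId (vonNeumann (fourierUnitary φ) - vonNeumann 1) (proj χ) = B * C := by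
    ext ⟨i, a⟩ ⟨j, b⟩
    rw [tensorId_sub_apply, Matrix.mul_apply]
    fin_cases i <;> fin_cases j <;>
      simp [B, C, Fintype.sum_prod_type, Fin.sum_univ_two] <;> ring
  have hn : ‖χ (0, 0)‖ ^ 2 + ‖χ (0, 1)‖ ^ 2 + (‖χ (1, 0)‖ ^ 2 + ‖χ (1, 1)‖ ^ 2) = 1 := by
    have h := EuclideanSpace.norm_sq_eq χ
    rw [hχ, Fintype.sum_prod_type] at h
    simpa [Fin.sum_univ_two] using h.symm
  have hB : ∑ m, ∑ k, ‖B k m‖ ^ 2 = 1 - Real.cos φ := by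
    have h0 := norm_vecMul_effectGap_sq φ (χ (0, 0)) (χ (1, 0))
    have h1 := norm_vecMul_effectGap_sq φ (χ (0, 1)) (χ (1, 1))
    simp only [B, Fintype.sum_prod_type, Fin.sum_univ_two, Matrix.of_apply, reduceIte, one_mul,
      neg_one_mul, norm_neg, zero_ne_one, one_ne_zero, norm_zero]
    linear_combination 2 * h0 + 2 * h1 + (1 - Real.cos φ) * hn
  have hC : ∑ m, ∑ k, ‖C m k‖ ^ 2 = 2 := by
    simp only [C, Fintype.sum_prod_type, Fin.sum_univ_two, Matrix.of_apply, reduceIte,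
      zero_ne_one, one_ne_zero, norm_zero, norm_star]
    linear_combination 2 * hn
  have h := traceNorm_mul_le B C
  rw [hB, hC, ← Real.sqrt_mul (sub_nonneg.mpr (Real.cos_le_one φ)), ← hBC,
    show (1 - Real.cos φ) * 2 = 2 - 2 * Real.cos φ by ring, ← norm_one_sub_exp_sq,
    Real.sqrt_sq (norm_nonneg _)] at h
  exact h

/-! ### The Bell state attains the bound. -/

theorem bellState_apply (i j : Fin 2) :
    bellState (i, j) = if i = j then ((Real.sqrt 2 : ℂ))⁻¹ else 0 := by
  simp [bellState, vectorize, Matrix.one_apply]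

theorem bellState_eq : bellState = ((Real.sqrt 2 : ℂ))⁻¹ • (ket 0 0 + ket 1 1) := by
  ext ⟨i, j⟩
  rw [bellState_apply]
  fin_cases i <;> fin_cases j <;> simp [ket]

theorem norm_bellState : ‖bellState‖ = 1 := by
  rw [EuclideanSpace.norm_eq, Fintype.sum_prod_type]
  simp [Fin.sum_univ_two, bellState_apply]
  norm_num

theorem star_effectGap_mul (φ : ℝ) (a b : Fin 2) :
    star (effectGap φ 0 a) * effectGap φ 0 b + star (effectGap φ 1 a) * effectGap φ 1 b =
      if a = b then (1 - (Real.cos φ : ℂ)) / 2 else 0 := by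
  have hcs : (Real.cos φ : ℂ) ^ 2 + (Real.sin φ : ℂ) ^ 2 = 1 := by
    rw [← Complex.ofReal_pow, ← Complex.ofReal_pow, ← Complex.ofReal_add,
      Real.cos_sq_add_sin_sq, Complex.ofReal_one]
  have hI := Complex.I_sq
  rw [effectGap]
  generalize Real.cos φ = x at *
  generalize Real.sin φ = y at *
  fin_cases a <;> fin_cases b <;> simp
  · linear_combination (hcs - (y : ℂ) ^ 2 * hI) / 4
  · ring
  · ring
  · linear_combination (hcs - (y : ℂ) ^ 2 * hI) / 4

theorem outputTraceNorm_bellState (φ : ℝ) :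
    outputTraceNorm (vonNeumann (fourierUnitary φ) - vonNeumann 1) bellState =
      ‖1 - Complex.exp (Complex.I * φ)‖ := by
  have hs : ((Real.sqrt 2 : ℂ))⁻¹ * ((Real.sqrt 2 : ℂ))⁻¹ = 1 / 2 := by
    rw [← mul_inv, ← Complex.ofReal_mul, Real.mul_self_sqrt (by norm_num)]
    norm_num
  have hentry : ∀ i a j b,
      tensorId (vonNeumann (fourierUnitary φ) - vonNeumann 1) (proj bellState) (i, a) (j, b) =
        if i = j then (if i = 0 then 1 else -1) * (effectGap φ a b / 2) else 0 := by
    intro i a j b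
    rw [tensorId_sub_apply]
    refine if_congr Iff.rfl ?_ rfl
    congr 1
    simp only [Fin.sum_univ_two, bellState_apply]
    fin_cases a <;> fin_cases b <;> simp <;> linear_combination effectGap φ _ _ * hs
  -- The output is 4 × 4 with all singular values equal, so each is a quarter of the trace norm.
  have h := traceNorm_of_conjTranspose_mul_self_eq_smul_one
    (tensorId (vonNeumann (fourierUnitary φ) - vonNeumann 1) (proj bellState))
    (‖1 - Complex.exp (Complex.I * φ)‖ / 4) (by positivity) ?_
  · rw [outputTraceNorm, h]
    simp
    ring
  · rw [div_pow, norm_one_sub_exp_sq]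
    ext ⟨i, a⟩ ⟨j, b⟩
    have hg := star_effectGap_mul φ a b
    rw [Matrix.mul_apply, Fintype.sum_prod_type]
    simp only [Fin.sum_univ_two, Matrix.conjTranspose_apply, hentry, Matrix.smul_apply,
      Matrix.one_apply, Prod.mk.injEq]
    by_cases hab : a = b <;> fin_cases i <;> fin_cases j <;> simp [hab] at hg ⊢ <;>
      linear_combination hg / 4

end Discrimination

end

theorem mainTheorem2 :
    Discrimination.bellState
        = ((Real.sqrt 2 : ℂ))⁻¹ • (Discrimination.ket 0 0 + Discrimination.ket 1 1) ∧
      ∀ φ : ℝ,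
        Discrimination.IsDiscriminator (Discrimination.fourierUnitary φ) 1
            Discrimination.bellState ∧
          Discrimination.outputTraceNorm
              (Discrimination.vonNeumann (Discrimination.fourierUnitary φ)
                - Discrimination.vonNeumann 1) Discrimination.bellState
            = ‖1 - Complex.exp (Complex.I * φ)‖ ∧
          Discrimination.diamondNorm
              (Discrimination.vonNeumann (Discrimination.fourierUnitary φ)
                - Discrimination.vonNeumann 1)
            = ‖1 - Complex.exp (Complex.I * φ)‖ := by
  refine ⟨Discrimination.bellState_eq, fun φ => ⟨⟨Discrimination.norm_bellState, fun χ hχ => ?_⟩,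
    Discrimination.outputTraceNorm_bellState φ, ?_⟩⟩
  · rw [Discrimination.outputTraceNorm_bellState]
    exact Discrimination.outputTraceNorm_le φ χ hχ
  · refine IsGreatest.csSup_eq ⟨⟨Discrimination.bellState, Discrimination.norm_bellState,
      Discrimination.outputTraceNorm_bellState φ⟩, ?_⟩
    rintro _ ⟨χ, hχ, rfl⟩
    exact Discrimination.outputTraceNorm_le φ χ hχ
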